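/- Let $\lambda$ be the fair-coin measure on $\{0,1\}^{\mathbb N}$. A Martin-Löf test is a uniformly computably enumerable sequence $(U_i)_{i\in\mathbb N}$ of open subsets of $\{0,1\}^{\mathbb N}$ with $\lambda(U_i)\le 2^{-i}$. It is universal if $\bigcap_i V_i\subseteq\bigcap_i U_i$ for every Martin-Löf test $(V_i)$, and optimal if for every Martin-Löf test $(V_i)$ there is an $n$ with $V_{i+n}\subseteq U_i$ for all $i$. Let $\mathrm{MLR}$ be the set of Martin-Löf random sequences, i.e. of those lying in $\bigcap_i V_i$ for no Martin-Löf test $(V_i)$. Computability of multivalued functions between represented spaces means the existence of a computable realizer on Baire space, and $\le_W$ is Weihrauch reducibility. A multivalued function $f:\mathrm{MLR}\rightrightarrows\mathbf Y$ (or $f:\mathrm{MLR}\times\mathbf X\rightrightarrows\mathbf Y$) is layerwise computable with respect to a test $U$ if a value of $f$ at $p$ (at $(p,x)$) can be computed, uniformly, from $p$ (and $x$) together with any $j\in\mathbb N$ such that $p\notin U_j$. A problem $f$ is Weihrauch complete for layerwise computability with respect to $U$ if it is layerwise computable with respect to $U$ and $g\le_W f$ for every $g:\mathrm{MLR}\rightrightarrows\mathbf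 Z$ that is layerwise computable with respect to $U$. For every $p\in\mathrm{MLR}$ the series $S(p)=\sum_{n\ge1}\frac{(-1)^{p(n)}}{n}$ converges. Let $\operatorname{SumApr}:\mathrm{MLR}\times\mathbb Q\times\mathbb N\rightrightarrows\{0,1\}$ be the multivalued function with $0\in\operatorname{SumApr}(p,q,k)$ iff $S(p)<q+2^{-k}$, and $1\in\operatorname{SumApr}(p,q,k)$ iff $S(p)>q$. Then: 1. $\operatorname{SumApr}$ is layerwise computable with respect to every optimal Martin-Löf test; 2. $\operatorname{SumApr}$ is not computable; 3. $\operatorname{SumApr}$ is not Weihrauch complete for layerwise computability; more precisely, for every universal Martin-Löf test $U$ there is a multivalued function $g:\mathrm{MLR}\rightrightarrows\mathbf Z$ that is layerwise computable with respect to $U$ but not Weihrauch reducible to $\operatorname{SumApr}$. -/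

import Mathlib

open Filter Topology MeasureTheory
open scoped ENNReal

namespace TTE

/-- Baire space `ℕ^ℕ`. -/
abbrev Baire : Type := ℕ → ℕ

/-- Cantor space `{0,1}^ℕ`. -/
abbrev Cantor : Type := ℕ → Bool

/-- The finite prefix `x(0) x(1) … x(k-1)` of an infinite sequence `x`. -/
def pre {α : Type} (x : ℕ → α) (k : ℕ) : List α := (List.range k).map x

/-- The standard pairing `⟨p, q⟩ = p(0) q(0) p(1) q(1) …` on Baire space. -/
def pair (p q : Baire) : Baire := fun n => if n % 2 = 0 then p (n / 2) else q (n / 2)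

/-! ### Computability on Baire space -/

/-- Computability of a partial function `F : ⊆ ℕ^ℕ → ℕ^ℕ` (Type-2 Turing computability):
there is a computable function `h` on finite words, monotone for the prefix order, such that
`F p` is defined exactly if the words `h (p(0) … p(k-1))`, `k ∈ ℕ`, grow beyond every length,
and `F p` is then the infinite sequence of which all these words are prefixes. -/
def ComputableBaire (F : Baire →. Baire) : Prop :=
  ∃ h : List ℕ → List ℕ, Computable h ∧
    (∀ u v : List ℕ, u <+: v → h u <+: h v) ∧
    ∀ p q : Baire, q ∈ F p ↔ ∀ n : ℕ, ∃ k : ℕ, (h (pre p k))[n]? = some (q n)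

/-! ### Represented spaces -/

/-- A represented space: a set with a partial surjection from Baire space onto it, the
partial surjection being given by its graph `Names` (`Names p x`: "`p` is a name of `x`"). -/
structure RepSpace where
  carrier : Type
  Names : Baire → carrier → Prop
  names_unique : ∀ {p : Baire} {x y : carrier}, Names p x → Names p y → x = y
  exists_name : ∀ x : carrier, ∃ p : Baire, Names p x

theorem pair_even (p q : Baire) : (fun n => pair p q (2 * n)) = p := by
  funext n
  simp [pair]

theorem pair_odd (p q : Baire) : (fun n => pair p q (2 * n + 1)) = q := by
  funext n
  have h1 : (2 * n + 1) % 2 = 1 := by omega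
  have h2 : (2 * n + 1) / 2 = n := by omega
  simp [pair, h1, h2]

namespace RepSpace

/-- The product of two represented spaces: `⟨p, q⟩` names `(x, y)` if `p` names `x` and `q`
names `y`. -/
@[reducible] def prod (X Y : RepSpace) : RepSpace where
  carrier := X.carrier × Y.carrier
  Names p z := X.Names (fun n => p (2 * n)) z.1 ∧ Y.Names (fun n => p (2 * n + 1)) z.2
  names_unique h h' := Prod.ext (X.names_unique h.1 h'.1) (Y.names_unique h.2 h'.2)
  exists_name z := by
    obtain ⟨p, hp⟩ := X.exists_name z.1
    obtain ⟨q, hq⟩ := Y.exists_name z.2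
    refine ⟨pair p q, ?_, ?_⟩
    · rw [pair_even]; exact hp
    · rw [pair_odd]; exact hq

/-- The subspace of a represented space given by a subset of its points, with the same names. -/
@[reducible] def sub (X : RepSpace) (A : Set X.carrier) : RepSpace where
  carrier := {x : X.carrier // x ∈ A}
  Names p x := X.Names p x.1
  names_unique h h' := Subtype.ext (X.names_unique h h')
  exists_name x := X.exists_name x.1

/-- The natural numbers: `p` names `p(0)`. -/
@[reducible] def nat : RepSpace where
  carrier := ℕ
  Names p n := p 0 = n
  names_unique h h' := h.symm.trans h'
  exists_name n := ⟨fun _ => n, rfl⟩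

/-- The two-point space `{0,1}`: `p` names `b` if `p(0) = b`. -/
@[reducible] def two : RepSpace where
  carrier := Fin 2
  Names p b := p 0 = b.val
  names_unique h h' := Fin.ext (h.symm.trans h')
  exists_name b := ⟨fun _ => b.val, rfl⟩

/-- The rational numbers: `p` names `(p(0) - p(1)) / (p(2) + 1)`. -/
@[reducible] def rat : RepSpace where
  carrier := ℚ
  Names p q := ((p 0 : ℚ) - (p 1 : ℚ)) / ((p 2 : ℚ) + 1) = q
  names_unique h h' := h.symm.trans h'
  exists_name q := by
    refine ⟨fun i => if i = 0 then q.num.toNat else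
      if i = 1 then (-q.num).toNat else q.den - 1, ?_⟩
    have h1 : ((q.num.toNat : ℕ) : ℚ) - (((-q.num).toNat : ℕ) : ℚ) = (q.num : ℚ) := by
      have h := Int.toNat_sub_toNat_neg q.num
      exact_mod_cast h
    have h2 : ((q.den - 1 : ℕ) : ℚ) + 1 = (q.den : ℚ) := by
      have h := q.den_pos
      have h3 : q.den - 1 + 1 = q.den := by omega
      exact_mod_cast h3
    simp only [if_true, one_ne_zero, if_false, OfNat.ofNat_ne_zero, OfNat.ofNat_ne_one]
    rw [h1, h2]
    exact Rat.num_div_den q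

/-- Cantor space: the only name of `x` is `x` itself, read as a sequence of numbers. -/
@[reducible] def cantor : RepSpace where
  carrier := Cantor
  Names p x := ∀ i : ℕ, p i = (x i).toNat
  names_unique {_ x y} h h' := funext fun i => by
    have e : (x i).toNat = (y i).toNat := (h i).symm.trans (h' i)
    revert e; cases x i <;> cases y i <;> simp
  exists_name x := ⟨fun i => (x i).toNat, fun _ => rfl⟩

end RepSpace

/-! ### Multivalued functions, realizers, Weihrauch reducibility -/

/-- A multivalued function from `X` to `Y`: `f x` is the set of admissible values at `x`. -/
abbrev Multi (X Y : RepSpace) : Type := X.carrier → Set Y.carrier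

/-- `F` realizes `f`: every name of every point `x` is mapped to a name of an element of
`f x`. -/
def Realizes {X Y : RepSpace} (F : Baire →. Baire) (f : Multi X Y) : Prop :=
  ∀ (p : Baire) (x : X.carrier), X.Names p x →
    ∃ r ∈ F p, ∃ y ∈ f x, Y.Names r y

/-- A multivalued function is computable if it has a computable realizer. -/
def IsComputableMulti {X Y : RepSpace} (f : Multi X Y) : Prop :=
  ∃ F : Baire →. Baire, ComputableBaire F ∧ Realizes F f

/-- Weihrauch reducibility `f ≤_W g`: there are computable `K, H : ⊆ ℕ^ℕ → ℕ^ℕ` such that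
`p ↦ K⟨p, G(H(p))⟩` realizes `f` whenever `G` realizes `g`. -/
def WeihrauchLE {X Y X' Y' : RepSpace} (f : Multi X Y) (g : Multi X' Y') : Prop :=
  ∃ K H : Baire →. Baire, ComputableBaire K ∧ ComputableBaire H ∧
    ∀ G : Baire →. Baire, Realizes G g →
      Realizes (fun p => (H p).bind fun a => (G a).bind fun b => K (pair p b)) f

/-! ### Martin-Löf randomness -/

/-- A computable sequence of open subsets of Cantor space: `U i` is the union of the cylinders
of the words in the `i`-th member of a uniformly computably enumerable family of sets of
finite words. -/
def IsComputableOpenSeq (U : ℕ → Set Cantor) : Prop :=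
  ∃ W : ℕ × List Bool → Prop, REPred W ∧
    ∀ i : ℕ, U i = {x : Cantor | ∃ w : List Bool, W (i, w) ∧ pre x w.length = w}

/-- The Lebesgue (fair coin tossing) measure on Cantor space. -/
noncomputable def lam : Measure Cantor :=
  Measure.infinitePi fun _ : ℕ => (PMF.uniformOfFintype Bool).toMeasure

/-- Martin-Löf tests. -/
def IsMLTest (U : ℕ → Set Cantor) : Prop :=
  IsComputableOpenSeq U ∧ ∀ i : ℕ, lam (U i) ≤ (2⁻¹ : ℝ≥0∞) ^ i

/-- Universal Martin-Löf tests. -/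
def IsUniversalMLTest (U : ℕ → Set Cantor) : Prop :=
  IsMLTest U ∧ ∀ V : ℕ → Set Cantor, IsMLTest V → (⋂ i, V i) ⊆ ⋂ i, U i

/-- Optimal Martin-Löf tests. -/
def IsOptimalMLTest (U : ℕ → Set Cantor) : Prop :=
  IsMLTest U ∧ ∀ V : ℕ → Set Cantor, IsMLTest V → ∃ n : ℕ, ∀ i : ℕ, V (i + n) ⊆ U i

/-- The set of Martin-Löf random sequences: those that pass every Martin-Löf test. -/
def MLR : Set Cantor :=
  {x : Cantor | ∀ V : ℕ → Set Cantor, IsMLTest V → x ∉ ⋂ i, V i}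

/-- The random sequences are the complement of the intersection of any universal test. -/
theorem MLR_eq_compl {U : ℕ → Set Cantor} (hU : IsUniversalMLTest U) :
    MLR = (⋂ i, U i)ᶜ := by
  ext x
  exact ⟨fun h => h U hU.1, fun h V hV hx => h (hU.2 V hV hx)⟩

/-- Optimal tests are universal. -/
theorem IsOptimalMLTest.universal {U : ℕ → Set Cantor} (hU : IsOptimalMLTest U) :
    IsUniversalMLTest U := by
  refine ⟨hU.1, fun V hV x hx => Set.mem_iInter.2 fun i => ?_⟩
  obtain ⟨n, hn⟩ := hU.2 V hV
  exact hn i (Set.mem_iInter.1 hx (i + n))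

/-- The random sequences as a represented space. -/
@[reducible] def mlr : RepSpace := RepSpace.cantor.sub MLR

/-! ### Layerwise computability -/

/-- A multivalued function `f` on the random sequences is layerwise computable (with respect to
the test `U`) if a value of `f` at `p` is computable from `p` together with any `k` such that
`p ∉ U k`. -/
def LayerwiseComputable (U : ℕ → Set Cantor) {Y : RepSpace} (f : Multi mlr Y) : Prop :=
  IsComputableMulti (X := (mlr.prod RepSpace.nat).sub {z | z.1.1 ∉ U z.2})
    (fun z => f z.1.1)

/-- Layerwise computability (with respect to the test `U`) for a multivalued function `f` that
takes a further argument `x ∈ X` besides the random sequence: a value of `f` at `(p, x)` is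
computable from `p`, `x` and any `k` such that `p ∉ U k`, uniformly in all three. -/
def LayerwiseComputableWith (U : ℕ → Set Cantor) {X Y : RepSpace} (f : Multi (mlr.prod X) Y) :
    Prop :=
  IsComputableMulti (X := ((mlr.prod X).prod RepSpace.nat).sub {z | z.1.1.1 ∉ U z.2})
    (fun z => f z.1.1)

/-- Weihrauch hardness of `g` for layerwise computability: every problem on the random sequences
that is layerwise computable (with respect to the test `U`) is Weihrauch reducible to `g`. -/
def WeihrauchHardForLayerwise (U : ℕ → Set Cantor) {X Y : RepSpace} (g : Multi X Y) : Prop :=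
  ∀ (Z : RepSpace) (f : Multi mlr Z), LayerwiseComputable U f → WeihrauchLE f g

/-- A problem `g` on random sequences and a further argument is Weihrauch complete for layerwise
computability (with respect to the test `U`) if it is layerwise computable and every layerwise
computable problem is Weihrauch reducible to it. -/
def WeihrauchCompleteForLayerwise (U : ℕ → Set Cantor) {X Y : RepSpace}
    (g : Multi (mlr.prod X) Y) : Prop :=
  LayerwiseComputableWith U g ∧ WeihrauchHardForLayerwise U g

/-! ### Random harmonic series -/

/-- The random harmonic series `∑_{n ≥ 1} (-1)^{x(n)} / n` converges to `s`. -/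
def HarmonicSum (x : Cantor) (s : ℝ) : Prop :=
  Tendsto (fun N : ℕ => ∑ n ∈ Finset.Icc 1 N, (-1 : ℝ) ^ (x n).toNat / (n : ℝ)) atTop (𝓝 s)

/-- The problem `SumApr : MLR × ℚ × ℕ ⇉ {0,1}`: `0` is admissible at `(p, q, k)` if the random
harmonic series of `p` has a sum smaller than `q + 2^{-k}`, and `1` is admissible if it has a
sum greater than `q`. -/
def SumApr : Multi (mlr.prod (RepSpace.rat.prod RepSpace.nat)) RepSpace.two :=
  fun z => {b : Fin 2 | ∃ s : ℝ, HarmonicSum z.1.1 s ∧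
    ((b = 0 ∧ s < (z.2.1 : ℝ) + (2 : ℝ)⁻¹ ^ z.2.2) ∨ (b = 1 ∧ (z.2.1 : ℝ) < s))}

end TTE

namespace TTE

open ProbabilityTheory

/-! ### The fair-coin measure -/

/-! Convergence and layerwise computability. Cut the series into blocks `t ^ 5 < n ≤ (t + 1) ^ 5`. A
block has at most `31 * t ^ 4` terms, each of square at most `t ^ (-10)`, so by Chebyshev its sum
reaches `t ^ (-2)` with probability at most `31 / t ^ 2`. The exceptional blocks with `t > 32 * 2 ^
i` therefore form a Martin-Löf test, `driftTest`. Outside its `i`-th component the partial sums from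
`cutoff i` on stay within `2 ^ (-i)` of the one at `cutoff i` (`abs_psum_cutoff_le`). Every random
sequence avoids some component, so its series converges. For an optimal test `U`, `p ∉ U j` gives `p
∉ driftTest (j + n)` with `n` fixed, hence a computable rate of convergence.

Noncomputability. Negating all bits after `m` reflects the sum in the `m`-th partial sum. As the
harmonic series diverges, any prefix can be continued until that partial sum is at least 1 (or at
most -1); of a random continuation and its reflection, one has a sum at least as extreme. So sums `≥
1` and `≤ -1` both occur in every cylinder (`exists_random_harmonicSum`), while an answer at `q =
0`, `k = 0` depends on a prefix only.

Incompleteness. The witness is `layerBound`: bound some `i` with `p ∉ U i`. A reduction to `SumApr`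
receives a single bit, so for each bit continuity freezes the proposed bound on a cylinder. Nesting
two such cylinders leaves one on which only two bounds are possible, yet random points of `U 0, …, U
J` are dense for every `J` (`exists_random_mem_agree`). -/

instance : IsProbabilityMeasure lam := by unfold lam; infer_instance

theorem uniform_bool_singleton (b : Bool) :
    (PMF.uniformOfFintype Bool).toMeasure {b} = 2⁻¹ := by
  rw [PMF.toMeasure_apply_singleton _ _ (measurableSet_singleton b)]
  simp

theorem lam_cylinder (x : Cantor) (n : ℕ) :
    lam {y | ∀ i < n, y i = x i} = (2⁻¹ : ℝ≥0∞) ^ n := by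
  have h : {y : Cantor | ∀ i < n, y i = x i} =
      Set.pi (Finset.range n : Set ℕ) fun i => {x i} := by
    ext y; simp [Set.mem_pi]
  rw [h, lam, Measure.infinitePi_pi _ (fun i _ => measurableSet_singleton _)]
  simp only [uniform_bool_singleton]
  simp

/-- Negating all bits from position `N` on. -/
def flipFrom (N : ℕ) (x : Cantor) : Cantor := fun n => if n < N then x n else !x n

/-- The map acts coordinatewise on a product measure, and negation preserves the fair coin. Hence
almost every `x` has both `x` and its flip random. -/
theorem measurePreserving_flipFrom (N : ℕ) : MeasurePreserving (flipFrom N) lam lam := by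
  have hm : Measurable (flipFrom N) := by
    refine measurable_pi_lambda _ fun n => ?_
    unfold flipFrom
    by_cases h : n < N
    · simpa [h] using measurable_pi_apply n
    · simpa [h, Function.comp_def] using (measurable_of_finite Bool.not).comp (measurable_pi_apply n)
  refine ⟨hm, ?_⟩
  have h := Measure.infinitePi_map_pi (fun _ : ℕ => (PMF.uniformOfFintype Bool).toMeasure)
    (f := fun n b => if n < N then b else !b) (fun n => measurable_of_finite _)
  have h' : ∀ n : ℕ, (PMF.uniformOfFintype Bool).toMeasure.map
      (fun b => if n < N then b else !b) = (PMF.uniformOfFintype Bool).toMeasure := by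
    intro n
    refine Measure.ext_of_singleton fun b => ?_
    rw [Measure.map_apply (measurable_of_finite _) (measurableSet_singleton b)]
    by_cases hn : n < N
    · simp [hn]
    · have : (fun b => if n < N then b else !b) ⁻¹' {b} = {!b} := by
        ext c; cases b <;> cases c <;> simp [hn]
      rw [this, uniform_bool_singleton, uniform_bool_singleton]
  simp only [h'] at h
  exact h

/-- The `n`-th random sign `(-1)^{x(n)}`. -/
def sign (n : ℕ) (x : Cantor) : ℝ := (-1) ^ (x n).toNat

theorem measurable_sign (n : ℕ) : Measurable (sign n) :=
  (measurable_of_finite fun b : Bool => (-1 : ℝ) ^ b.toNat).comp (measurable_pi_apply n)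

theorem abs_sign (n : ℕ) (x : Cantor) : |sign n x| = 1 := by
  unfold sign; simp

theorem sign_sq (n : ℕ) (x : Cantor) : sign n x ^ 2 = 1 := by
  rw [← sq_abs, abs_sign, one_pow]

theorem memLp_sign (n : ℕ) : MemLp (sign n) 2 lam :=
  MemLp.of_bound (measurable_sign n).aestronglyMeasurable 1
    (ae_of_all _ fun x => by rw [Real.norm_eq_abs, abs_sign])

theorem integral_sign (n : ℕ) : ∫ x, sign n x ∂lam = 0 := by
  have h := (measurePreserving_eval_infinitePi
    (fun _ : ℕ => (PMF.uniformOfFintype Bool).toMeasure) n)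
  have h2 : ∫ x, sign n x ∂lam =
      ∫ b, (-1 : ℝ) ^ b.toNat ∂(PMF.uniformOfFintype Bool).toMeasure := by
    rw [← h.map_eq, integral_map h.measurable.aemeasurable
      (measurable_of_finite _).aestronglyMeasurable]
    rfl
  rw [h2, PMF.integral_eq_sum]
  simp

theorem iIndepFun_sign : iIndepFun sign lam :=
  iIndepFun_infinitePi (P := fun _ : ℕ => (PMF.uniformOfFintype Bool).toMeasure)
    (X := fun _ b => (-1 : ℝ) ^ b.toNat) (fun _ => measurable_of_finite _)

theorem variance_sign (n : ℕ) : variance (sign n) lam = 1 := by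
  rw [variance_eq_sub (memLp_sign n), integral_sign]
  simp [sign_sq]

/-- Chebyshev's inequality for weighted sums of random signs. -/
theorem lam_abs_sum_sign_ge (s : Finset ℕ) (a : ℕ → ℝ) {c : ℝ} (hc : 0 < c) :
    lam {x | c ≤ |∑ n ∈ s, a n * sign n x|} ≤ ENNReal.ofReal ((∑ n ∈ s, a n ^ 2) / c ^ 2) := by
  have hL : ∀ n, MemLp (fun x => a n * sign n x) 2 lam := fun n => (memLp_sign n).const_mul _
  have hLs : MemLp (∑ n ∈ s, fun x => a n * sign n x) 2 lam := memLp_finsetSum' s fun n _ => hL n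
  have hv : variance (∑ n ∈ s, fun x => a n * sign n x) lam = ∑ n ∈ s, a n ^ 2 := by
    rw [IndepFun.variance_sum (fun n _ => hL n)]
    · refine Finset.sum_congr rfl fun n _ => ?_
      rw [variance_const_mul, variance_sign, mul_one]
    · intro i _ j _ hij
      exact (iIndepFun_sign.indepFun hij).comp (measurable_const_mul (a i))
        (measurable_const_mul (a j))
  have hE : ∫ x, (∑ n ∈ s, fun x => a n * sign n x) x ∂lam = 0 := by
    simp only [Finset.sum_apply]
    rw [integral_finsetSum _ fun n _ => (hL n).integrable one_le_two]
    simp [integral_const_mul, integral_sign]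
  have h := meas_ge_le_variance_div_sq hLs hc
  rw [hE, hv] at h
  simpa using h

/-! ### Prefixes -/

theorem pre_length {α : Type} (x : ℕ → α) (k : ℕ) : (pre x k).length = k := by simp [pre]

theorem pre_eq_pre_iff {α : Type} {x y : ℕ → α} {n : ℕ} :
    pre y n = pre x n ↔ ∀ i < n, y i = x i := by
  simp [pre, List.map_inj_left]

theorem pre_getElem? {α : Type} (x : ℕ → α) {i k : ℕ} (h : i < k) : (pre x k)[i]? = some (x i) := by
  simp [pre, h]

theorem pre_prefix {α : Type} (x : ℕ → α) {k m : ℕ} (h : k ≤ m) : pre x k <+: pre x m := by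
  refine List.prefix_iff_eq_take.2 ?_
  rw [pre_length]
  simp [pre, ← List.map_take, List.take_range, h]

theorem getElem?_of_prefix {α : Type} {u v : List α} (h : u <+: v) {n : ℕ} {a : α}
    (ha : u[n]? = some a) : v[n]? = some a := by
  obtain ⟨t, rfl⟩ := h
  have hn : n < u.length := (List.getElem?_eq_some_iff.1 ha).1
  rw [List.getElem?_append_left hn, ha]

/-! ### Computable functions on Baire space -/

/-- Monotonicity makes the limit sequence unique, so choosing one defines the partial function. -/
theorem exists_computableBaire {h : List ℕ → List ℕ} (hc : Computable h)
    (hm : ∀ u v : List ℕ, u <+: v → h u <+: h v) :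
    ∃ F : Baire →. Baire, ComputableBaire F ∧
      ∀ p q : Baire, q ∈ F p ↔ ∀ n : ℕ, ∃ k : ℕ, (h (pre p k))[n]? = some (q n) := by
  classical
  let F : Baire →. Baire := fun p =>
    ⟨∃ q : Baire, ∀ n : ℕ, ∃ k : ℕ, (h (pre p k))[n]? = some (q n), fun H => H.choose⟩
  have hF : ∀ p q : Baire, q ∈ F p ↔ ∀ n : ℕ, ∃ k : ℕ, (h (pre p k))[n]? = some (q n) := by
    intro p q
    constructor
    · rintro ⟨H, rfl⟩
      exact H.choose_spec
    · intro hq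
      refine ⟨⟨q, hq⟩, ?_⟩
      have hex : ∃ q : Baire, ∀ n : ℕ, ∃ k : ℕ, (h (pre p k))[n]? = some (q n) := ⟨q, hq⟩
      change hex.choose = q
      funext n
      obtain ⟨k, hk⟩ := hq n
      obtain ⟨l, hl⟩ := hex.choose_spec n
      have h1 := getElem?_of_prefix (hm _ _ (pre_prefix p (le_max_left k l))) hk
      have h2 := getElem?_of_prefix (hm _ _ (pre_prefix p (le_max_right k l))) hl
      exact Option.some.inj (h2.symm.trans h1)
  exact ⟨F, ⟨h, hc, hm, hF⟩, hF⟩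

/-- A single number that is computed from a finite prefix can be output as a constant sequence. -/
theorem exists_computableBaire_const {c : List ℕ → Option ℕ} (hc : Computable c)
    (hm : ∀ u v : List ℕ, u <+: v → ∀ b, c u = some b → c v = some b) :
    ∃ F : Baire →. Baire, ComputableBaire F ∧
      ∀ (p : Baire) (k b : ℕ), c (pre p k) = some b → (fun _ => b) ∈ F p := by
  -- Once the number is known, it is repeated as often as the input word is long, so the output
  -- grows without bound.
  let h : List ℕ → List ℕ := fun u =>
    (c u).elim [] fun b => (List.range u.length).map fun _ => b
  have hcomp : Computable h := by
    refine (Computable.option_casesOn (o := c) hc (Computable.const [])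
      (g := fun u b => (List.range u.length).map fun _ => b) ?_).of_eq fun u => ?_
    · exact (Primrec.list_map (Primrec.list_range.comp (Primrec.list_length.comp Primrec.fst))
        (Primrec.snd.comp Primrec.fst).to₂).to_comp.to₂
    · simp only [h]
      cases c u <;> rfl
  have hmono : ∀ u v : List ℕ, u <+: v → h u <+: h v := by
    intro u v huv
    simp only [h]
    cases hu : c u with
    | none => simp
    | some b =>
      rw [hm u v huv b hu]
      simp only [Option.elim_some, List.map_const', List.length_range]
      rw [← Nat.add_sub_of_le huv.length_le, List.replicate_add]
      exact List.prefix_append _ _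
  obtain ⟨F, hF, hF'⟩ := exists_computableBaire hcomp hmono
  refine ⟨F, hF, fun p k b hb => (hF' p _).2 fun n => ⟨max k (n + 1), ?_⟩⟩
  have hb' := hm _ _ (pre_prefix p (le_max_left k (n + 1))) b hb
  have hn : n < max k (n + 1) := lt_of_lt_of_le n.lt_succ_self (le_max_right _ _)
  simp only [h, hb', Option.elim_some, pre_length]
  simp

/-- The first entry of the output depends on a finite prefix of the input only. -/
theorem ComputableBaire.continuous_zero {F : Baire →. Baire} (hF : ComputableBaire F)
    {p q : Baire} (hq : q ∈ F p) :
    ∃ k : ℕ, ∀ p' : Baire, (∀ i < k, p' i = p i) → ∀ q' ∈ F p', q' 0 = q 0 := by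
  obtain ⟨h, -, hm, hF⟩ := hF
  obtain ⟨k, hk⟩ := (hF p q).1 hq 0
  refine ⟨k, fun p' hp' q' hq' => ?_⟩
  obtain ⟨l, hl⟩ := (hF p' q').1 hq' 0
  rw [← pre_eq_pre_iff.2 hp'] at hk
  have h1 := getElem?_of_prefix (hm _ _ (pre_prefix p' (le_max_left k l))) hk
  have h2 := getElem?_of_prefix (hm _ _ (pre_prefix p' (le_max_right k l))) hl
  exact Option.some.inj (h2.symm.trans h1)

/-! ### Random sequences -/

theorem lam_iInter_eq_zero {V : ℕ → Set Cantor} (hV : ∀ i, lam (V i) ≤ (2⁻¹ : ℝ≥0∞) ^ i) :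
    lam (⋂ i, V i) = 0 := by
  have h := ENNReal.tendsto_pow_atTop_nhds_zero_of_lt_one (r := 2⁻¹) (by simp)
  exact le_antisymm
    (ge_of_tendsto' h fun i => (measure_mono (Set.iInter_subset V i)).trans (hV i)) (zero_le)

/-- Each such predicate is the domain of one of countably many codes. This leaves only countably
many Martin-Löf tests. -/
theorem countable_setOf_rePred {α : Type} [Primcodable α] : {W : α → Prop | REPred W}.Countable := by
  refine (Set.countable_range fun c : Nat.Partrec.Code =>
    fun a : α => (c.eval (Encodable.encode a)).Dom).mono fun W hW => ?_
  obtain ⟨c, hc⟩ := Nat.Partrec.Code.exists_code.1 hW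
  refine ⟨c, funext fun a => propext ?_⟩
  simp [hc, Part.assert]

/-- Almost every sequence is random. -/
theorem lam_compl_MLR : lam MLRᶜ = 0 := by
  let O : (ℕ × List Bool → Prop) → ℕ → Set Cantor := fun W i =>
    {x : Cantor | ∃ w : List Bool, W (i, w) ∧ pre x w.length = w}
  have hc : {W : ℕ × List Bool → Prop | REPred W ∧ IsMLTest (O W)}.Countable :=
    countable_setOf_rePred.mono fun W hW => hW.1
  refine measure_mono_null (t := ⋃ W ∈ {W : ℕ × List Bool → Prop | REPred W ∧ IsMLTest (O W)},
    ⋂ i, O W i) ?_ ((measure_biUnion_null_iff hc).2 fun W hW => lam_iInter_eq_zero hW.2.2)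
  intro x hx
  simp only [MLR, Set.mem_compl_iff, Set.mem_ofPred_eq, not_forall, not_not] at hx
  obtain ⟨V, hV, hxV⟩ := hx
  obtain ⟨W, hW, hVW⟩ := hV.1
  obtain rfl : V = O W := funext hVW
  exact Set.mem_biUnion (show W ∈ {W | REPred W ∧ IsMLTest (O W)} from ⟨hW, hV⟩) hxV

/-- Conull sets are dense. -/
theorem exists_mem_agree {S : Set Cantor} (hS : lam Sᶜ = 0) (x : Cantor) (n : ℕ) :
    ∃ y ∈ S, ∀ i < n, y i = x i := by
  by_contra! h
  have h0 : lam {y | ∀ i < n, y i = x i} = 0 :=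
    measure_mono_null (t := Sᶜ) (fun y hy => fun hyS => by
      obtain ⟨i, hi, hne⟩ := h y hyS
      exact hne (hy i hi)) hS
  rw [lam_cylinder] at h0
  simp at h0

theorem IsComputableOpenSeq.isOpen {U : ℕ → Set Cantor} (hU : IsComputableOpenSeq U) {i : ℕ}
    {x : Cantor} (hx : x ∈ U i) : ∃ n : ℕ, ∀ y : Cantor, (∀ k < n, y k = x k) → y ∈ U i := by
  obtain ⟨W, -, hW⟩ := hU
  rw [hW] at hx ⊢
  obtain ⟨w, hw, hxw⟩ := hx
  exact ⟨w.length, fun y hy => ⟨w, hw, (pre_eq_pre_iff.2 hy).trans hxw⟩⟩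

/-- The cylinders around an eventually vanishing sequence form a Martin-Löf test. -/
theorem isMLTest_cylinder {x : Cantor} {N : ℕ} (hx : ∀ i ≥ N, x i = false) :
    IsMLTest fun i => {y | ∀ k < N + i, y k = x k} := by
  refine ⟨⟨fun a => a.2 = pre x N ++ (List.range a.1).map fun _ => false, ?_, fun i => ?_⟩,
    fun i => ?_⟩
  · have h : PrimrecPred fun a : ℕ × List Bool =>
        a.2 = pre x N ++ (List.range a.1).map fun _ => false :=
      Primrec.eq.comp Primrec.snd (Primrec.list_append.comp (Primrec.const _)
        (Primrec.list_map (Primrec.list_range.comp Primrec.fst) (Primrec.const false).to₂))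
    exact h.computablePred.to_re
  · have h : pre x N ++ (List.range i).map (fun _ => false) = pre x (N + i) := by
      rw [pre, pre, List.range_add, List.map_append, List.map_map]
      congr 1
      exact List.map_congr_left fun k _ => (hx _ (Nat.le_add_right N k)).symm
    ext y
    simp only [h, Set.mem_ofPred_eq, exists_eq_left, pre_length]
    exact pre_eq_pre_iff.symm
  · rw [lam_cylinder]
    exact pow_le_pow_of_le_one zero_le (by simp) (Nat.le_add_left i N)

/-- Random sequences that lie in the first components of a universal test are dense. -/
theorem exists_random_mem_agree {U : ℕ → Set Cantor} (hU : IsUniversalMLTest U) (J : ℕ)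
    (x : Cantor) (n : ℕ) : ∃ p ∈ MLR, (∀ i < n, p i = x i) ∧ ∀ i ≤ J, p ∈ U i := by
  -- An eventually zero sequence is caught by a test of cylinders, so by universality it lies in
  -- every `U i`; openness passes this on to nearby random sequences.
  let x' : Cantor := fun i => if i < n then x i else false
  have hx' : ∀ i ≥ n, x' i = false := fun i hi => if_neg (not_lt.2 hi)
  have hmem : ∀ i, x' ∈ U i := Set.mem_iInter.1
    (hU.2 _ (isMLTest_cylinder hx') (Set.mem_iInter.2 fun i k _ => rfl))
  choose N hN using fun i => hU.1.1.isOpen (hmem i)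
  obtain ⟨p, hp, hpx⟩ := exists_mem_agree lam_compl_MLR x' (max n ((Finset.range (J + 1)).sup N))
  refine ⟨p, hp, fun i hi => ?_, fun i hi => hN i p fun k hk => hpx k ?_⟩
  · rw [hpx i (lt_max_of_lt_left hi)]
    exact if_pos hi
  · exact lt_max_of_lt_right
      (lt_of_lt_of_le hk (Finset.le_sup (Finset.mem_range.2 (Nat.lt_succ_of_le hi))))

/-! ### A layerwise computable problem beyond finite codomains -/

/-- The problem of finding an upper bound for some layer `i` with `p ∉ U i`. -/
def layerBound (U : ℕ → Set Cantor) : Multi mlr RepSpace.nat :=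
  fun p => {j : ℕ | ∃ i ≤ j, p.1 ∉ U i}

theorem layerwiseComputable_layerBound (U : ℕ → Set Cantor) :
    LayerwiseComputable U (layerBound U) := by
  -- Entry 1 of the paired name is the given layer index, which is itself a valid bound.
  obtain ⟨F, hF, hF'⟩ := exists_computableBaire_const (c := fun u => u[1]?)
    (Primrec.list_getElem?.comp Primrec.id (Primrec.const 1)).to_comp
    (fun u v huv b hb => getElem?_of_prefix huv hb)
  refine ⟨F, hF, fun p z hz => ⟨_, hF' p 2 (p 1) (pre_getElem? p one_lt_two), z.1.2, ?_, ?_⟩⟩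
  · exact ⟨z.1.2, le_rfl, z.2⟩
  · exact hz.2

theorem pair_congr_left {p p' q : Baire} {k : ℕ} (h : ∀ i < k, p' i = p i) :
    ∀ i < k, pair p' q i = pair p q i := by
  intro i hi
  unfold pair
  split_ifs
  · exact h _ (lt_of_le_of_lt (Nat.div_le_self i 2) hi)
  · rfl

/-- A total multivalued function with values in `{0,1}` has a realizer with constant
outputs. -/
theorem exists_realizes_const {X : RepSpace} (f : Multi X RepSpace.two)
    (hf : ∀ x, (f x).Nonempty) :
    ∃ G : Baire →. Baire, Realizes G f ∧ ∀ a, ∀ r ∈ G a, ∃ b < 2, r = fun _ => b := by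
  classical
  choose s hs using hf
  refine ⟨fun a => Part.some fun _ => if h : ∃ x, X.Names a x then (s h.choose).val else 0,
    fun a x hx => ?_, fun a r hr => ⟨_, ?_, Part.mem_some_iff.1 hr⟩⟩
  · have hex : ∃ x, X.Names a x := ⟨x, hx⟩
    have hx' : hex.choose = x := X.names_unique hex.choose_spec hx
    refine ⟨_, Part.mem_some _, s x, hs x, ?_⟩
    simp only [dif_pos hex, hx']
  · split_ifs with h
    · exact (s h.choose).isLt
    · norm_num

/-- The bounding problem of a universal test is not reducible to a total problem with values
in `{0,1}`. -/
theorem not_weihrauchLE_layerBound {U : ℕ → Set Cantor} (hU : IsUniversalMLTest U)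
    {X : RepSpace} (f : Multi X RepSpace.two) (hf : ∀ x, (f x).Nonempty) :
    ¬ WeihrauchLE (layerBound U) f := by
  rintro ⟨K, H, hK, -, hKH⟩
  let name : Cantor → Baire := fun x i => (x i).toNat
  obtain ⟨G, hG, hG'⟩ := exists_realizes_const f hf
  have key : ∀ p ∈ MLR, ∃ b < 2, ∃ r ∈ K (pair (name p) fun _ => b), ∃ i ≤ r 0, p ∉ U i := by
    intro p hp
    obtain ⟨r, hr, y, hy, hry⟩ := hKH G hG (name p) ⟨p, hp⟩ fun _ => rfl
    obtain ⟨a, -, hr⟩ := Part.mem_bind_iff.1 hr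
    obtain ⟨g, hg, hr⟩ := Part.mem_bind_iff.1 hr
    obtain ⟨b, hb, rfl⟩ := hG' a g hg
    obtain rfl : r 0 = y := hry
    exact ⟨b, hb, r, hr, hy⟩
  -- Either `K` with bit `b` is defined at some random point of the cylinder, and continuity fixes
  -- its bound nearby, or it is defined at none and the claim is vacuous.
  have step : ∀ (b : ℕ) (x : Cantor) (n : ℕ), ∃ (y : Cantor) (m j : ℕ), n ≤ m ∧
      (∀ i < n, y i = x i) ∧ ∀ p ∈ MLR, (∀ i < m, p i = y i) →
        ∀ r ∈ K (pair (name p) fun _ => b), r 0 = j := by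
    intro b x n
    by_cases h : ∃ y ∈ MLR, (∀ i < n, y i = x i) ∧ ∃ r, r ∈ K (pair (name y) fun _ => b)
    · obtain ⟨y, -, hyx, r, hr⟩ := h
      obtain ⟨k, hk⟩ := hK.continuous_zero hr
      refine ⟨y, max n k, r 0, le_max_left _ _, hyx, fun p _ hpy r' hr' => hk _ ?_ r' hr'⟩
      refine pair_congr_left fun i hi => ?_
      simp only [name, hpy i (lt_max_of_lt_right hi)]
    · push Not at h
      exact ⟨x, n, 0, le_rfl, fun _ _ => rfl, fun p hp hpx r hr => absurd hr (h p hp hpx r)⟩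
  obtain ⟨y, m, j₀, -, -, h₀⟩ := step 0 (fun _ => false) 0
  obtain ⟨z, l, j₁, hml, hzy, h₁⟩ := step 1 y m
  obtain ⟨p, hp, hpz, hpU⟩ := exists_random_mem_agree hU (max j₀ j₁) z l
  obtain ⟨b, hb, r, hr, i, hi, hpi⟩ := key p hp
  refine hpi (hpU i (hi.trans ?_))
  interval_cases b
  · rw [h₀ p hp (fun i hi => (hpz i (hi.trans_le hml)).trans (hzy i hi)) r hr]
    exact le_max_left _ _
  · rw [h₁ p hp hpz r hr]
    exact le_max_right _ _

/-! ### Partial sums as fractions -/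

/-- The sum of `(-1)^{c(n)} / n` over `N < n ≤ N + L`, as a triple `(a, b, d)` that represents
`(a - b) / d`. -/
def fracSum (c : ℕ → Bool) (N : ℕ) : ℕ → ℕ × ℕ × ℕ
  | 0 => (0, 0, 1)
  | L + 1 =>
    ((fracSum c N L).1 * (N + L + 1) + bif c (N + L + 1) then 0 else (fracSum c N L).2.2,
      (fracSum c N L).2.1 * (N + L + 1) + bif c (N + L + 1) then (fracSum c N L).2.2 else 0,
      (fracSum c N L).2.2 * (N + L + 1))

theorem fracSum_congr {c c' : ℕ → Bool} {N L : ℕ} (h : ∀ n ≤ N + L, c n = c' n) :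
    fracSum c N L = fracSum c' N L := by
  induction L with
  | zero => rfl
  | succ L ih =>
    rw [fracSum, fracSum, ih fun n hn => h n (hn.trans (by omega)), h (N + L + 1) (by omega)]

theorem primrec_fracSum {α : Type} [Primcodable α] {f : α → ℕ → Bool} {N L : α → ℕ}
    (hf : Primrec₂ f) (hN : Primrec N) (hL : Primrec L) :
    Primrec fun a => fracSum (f a) (N a) (L a) := by
  have hn : Primrec fun y : α × ℕ × ℕ × ℕ × ℕ => N y.1 + y.2.1 + 1 :=
    Primrec.nat_add.comp (Primrec.nat_add.comp (hN.comp Primrec.fst)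
      (Primrec.fst.comp Primrec.snd)) (Primrec.const 1)
  have hb : Primrec fun y : α × ℕ × ℕ × ℕ × ℕ => f y.1 (N y.1 + y.2.1 + 1) :=
    hf.comp Primrec.fst hn
  have hs : Primrec fun y : α × ℕ × ℕ × ℕ × ℕ => y.2.2 := Primrec.snd.comp Primrec.snd
  have h1 := Primrec.fst.comp hs
  have h2 := Primrec.fst.comp (Primrec.snd.comp hs)
  have h3 := Primrec.snd.comp (Primrec.snd.comp hs)
  have hstep : Primrec₂ fun (a : α) (y : ℕ × ℕ × ℕ × ℕ) =>
      (y.2.1 * (N a + y.1 + 1) + (bif f a (N a + y.1 + 1) then 0 else y.2.2.2),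
        y.2.2.1 * (N a + y.1 + 1) + (bif f a (N a + y.1 + 1) then y.2.2.2 else 0),
        y.2.2.2 * (N a + y.1 + 1)) :=
    (Primrec.nat_add.comp (Primrec.nat_mul.comp h1 hn)
      (Primrec.cond hb (Primrec.const 0) h3)).pair
      ((Primrec.nat_add.comp (Primrec.nat_mul.comp h2 hn)
        (Primrec.cond hb h3 (Primrec.const 0))).pair (Primrec.nat_mul.comp h3 hn))
  refine (Primrec.nat_rec' hL (Primrec.const (0, 0, 1)) hstep).of_eq fun a => ?_
  generalize L a = l
  induction l with
  | zero => rfl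
  | succ l ih => rw [fracSum, ← ih]

/-- The partial sum of the random harmonic series over `N < n ≤ M`. -/
noncomputable def psum (x : Cantor) (N M : ℕ) : ℝ := ∑ n ∈ Finset.Ioc N M, (n : ℝ)⁻¹ * sign n x

theorem fracSum_den_pos (c : ℕ → Bool) (N L : ℕ) : 0 < (fracSum c N L).2.2 := by
  induction L with
  | zero => exact Nat.one_pos
  | succ L ih => exact Nat.mul_pos ih (Nat.succ_pos _)

theorem fracSum_eq (x : Cantor) (N L : ℕ) :
    (((fracSum x N L).1 : ℝ) - (fracSum x N L).2.1) / (fracSum x N L).2.2 =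
      psum x N (N + L) := by
  induction L with
  | zero => simp [fracSum, psum]
  | succ L ih =>
    have hd : ((fracSum x N L).2.2 : ℝ) ≠ 0 := by exact_mod_cast (fracSum_den_pos x N L).ne'
    have hn : ((N : ℝ) + L + 1) ≠ 0 := by positivity
    rw [psum, ← add_assoc, Finset.sum_Ioc_succ_top (by omega), ← psum, ← ih, fracSum, sign]
    push_cast
    cases x (N + L + 1) <;> simp <;> field_simp <;> ring

theorem harmonicSum_iff {x : Cantor} {s : ℝ} :
    HarmonicSum x s ↔ Tendsto (fun N => psum x 0 N) atTop (𝓝 s) := by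
  have h : (fun N : ℕ => ∑ n ∈ Finset.Icc 1 N, (-1 : ℝ) ^ (x n).toNat / (n : ℝ)) =
      fun N => psum x 0 N := by
    funext N
    exact Finset.sum_congr rfl fun n _ => by rw [sign, div_eq_inv_mul]
  rw [HarmonicSum, h]

theorem psum_add (x : Cantor) {N M K : ℕ} (h : N ≤ M) (h' : M ≤ K) :
    psum x N M + psum x M K = psum x N K :=
  Finset.sum_Ioc_consecutive _ h h'

/-! ### A test for fast convergence -/

/-- Here 31 = 5 + 10 + 10 + 5 + 1, the lower binomial coefficients with every power raised to `t ^
4`. -/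
theorem pow_five_step (t : ℕ) (ht : 1 ≤ t) : (t + 1) ^ 5 ≤ t ^ 5 + 31 * t ^ 4 := by
  have h4 : t ^ 3 ≤ t ^ 4 := Nat.pow_le_pow_right ht (by norm_num)
  have h3 : t ^ 2 ≤ t ^ 4 := Nat.pow_le_pow_right ht (by norm_num)
  have h2 : t ≤ t ^ 4 := Nat.le_self_pow (by norm_num) t
  have h1 : 1 ≤ t ^ 4 := Nat.one_le_pow _ _ ht
  nlinarith

theorem card_block_le {t m : ℕ} (ht : 1 ≤ t) (hm : m ≤ (t + 1) ^ 5) :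
    ((Finset.Ioc (t ^ 5) m).card : ℝ) ≤ 31 * t ^ 4 := by
  have h := pow_five_step t ht
  rw [Nat.card_Ioc]
  exact_mod_cast (show m - t ^ 5 ≤ 31 * t ^ 4 by omega)

/-- The sequences for which a late block of the random harmonic series has a large sum. -/
def driftTest (i : ℕ) : Set Cantor :=
  {x | ∃ t : ℕ, t > 32 * 2 ^ i ∧ ((t : ℝ) ^ 2)⁻¹ ≤ |psum x (t ^ 5) ((t + 1) ^ 5)|}

theorem lam_block_le {t : ℕ} (ht : 1 ≤ t) :
    lam {x | ((t : ℝ) ^ 2)⁻¹ ≤ |psum x (t ^ 5) ((t + 1) ^ 5)|} ≤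
      ENNReal.ofReal (31 / (t : ℝ) ^ 2) := by
  have ht' : (0 : ℝ) < t := by exact_mod_cast ht
  refine (lam_abs_sum_sign_ge _ (fun n => (n : ℝ)⁻¹) (by positivity)).trans
    (ENNReal.ofReal_le_ofReal ?_)
  have hsum : ∑ n ∈ Finset.Ioc (t ^ 5) ((t + 1) ^ 5), ((n : ℝ)⁻¹) ^ 2 ≤
      31 * t ^ 4 * (((t : ℝ) ^ 5)⁻¹) ^ 2 := by
    refine (Finset.sum_le_card_nsmul _ _ ((((t : ℝ) ^ 5)⁻¹) ^ 2) fun n hn => ?_).trans ?_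
    · have hn' : (t : ℝ) ^ 5 ≤ n := by exact_mod_cast (Finset.mem_Ioc.1 hn).1.le
      gcongr
    · rw [nsmul_eq_mul]
      exact mul_le_mul_of_nonneg_right (card_block_le ht le_rfl) (by positivity)
  calc _ ≤ 31 * t ^ 4 * (((t : ℝ) ^ 5)⁻¹) ^ 2 / (((t : ℝ) ^ 2)⁻¹) ^ 2 := by gcongr
    _ = 31 / (t : ℝ) ^ 2 := by field_simp

/-- Telescoping: `1 / t ^ 2 ≤ 1 / (t - 1) - 1 / t` for `t = T + 1 + s`. -/
theorem sum_inv_sq_le (T : ℕ) (hT : 1 ≤ T) (n : ℕ) :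
    ∑ s ∈ Finset.range n, 31 / ((T + 1 + s : ℕ) : ℝ) ^ 2 ≤ 31 * ((T : ℝ)⁻¹ - ((T : ℝ) + n)⁻¹) := by
  have hT' : (0 : ℝ) < T := by exact_mod_cast hT
  induction n with
  | zero => simp
  | succ n ih =>
    rw [Finset.sum_range_succ]
    have h : 31 / ((T + 1 + n : ℕ) : ℝ) ^ 2 ≤
        31 * (((T : ℝ) + n)⁻¹ - ((T : ℝ) + (n + 1 : ℕ))⁻¹) := by
      have hn : (0 : ℝ) < T + n := by positivity
      push_cast
      rw [inv_sub_inv (by positivity) (by positivity), ← mul_div_assoc,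
        div_le_div_iff₀ (by positivity) (by positivity)]
      nlinarith
    linarith

theorem lam_driftTest_le (i : ℕ) : lam (driftTest i) ≤ (2⁻¹ : ℝ≥0∞) ^ i := by
  set T : ℕ := 32 * 2 ^ i with hTdef
  have hT : 1 ≤ T := by have := Nat.one_le_two_pow (n := i); omega
  have hsub : driftTest i ⊆ ⋃ s : ℕ,
      {x | (((T + 1 + s : ℕ) : ℝ) ^ 2)⁻¹ ≤ |psum x ((T + 1 + s) ^ 5) ((T + 1 + s + 1) ^ 5)|} := by
    rintro x ⟨t, ht, hx⟩
    refine Set.mem_iUnion.2 ⟨t - (T + 1), ?_⟩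
    have : T + 1 + (t - (T + 1)) = t := by omega
    rw [this]
    exact hx
  refine (measure_mono hsub).trans ((measure_iUnion_le _).trans
    (ENNReal.tsum_le_of_sum_range_le fun n => ?_))
  refine (Finset.sum_le_sum fun s _ => lam_block_le (t := T + 1 + s) (by omega)).trans ?_
  rw [← ENNReal.ofReal_sum_of_nonneg fun s _ => by positivity]
  have h2 : (2⁻¹ : ℝ≥0∞) ^ i = ENNReal.ofReal ((2 : ℝ)⁻¹ ^ i) := by
    rw [ENNReal.ofReal_pow (by norm_num), ENNReal.ofReal_inv_of_pos (by norm_num)]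
    norm_num
  rw [h2]
  refine ENNReal.ofReal_le_ofReal ((sum_inv_sq_le T hT n).trans ?_)
  have h3 : (0 : ℝ) ≤ ((T : ℝ) + n)⁻¹ := by positivity
  have h4 : (T : ℝ)⁻¹ = 32⁻¹ * (2 : ℝ)⁻¹ ^ i := by
    rw [hTdef]; push_cast; rw [mul_inv, inv_pow]
  have h5 : (0 : ℝ) < (2 : ℝ)⁻¹ ^ i := by positivity
  rw [h4]
  linarith

/-- Clearing denominators turns the defining inequality of `driftTest` into arithmetic on naturals,
which is primitive recursive. -/
theorem inv_sq_le_abs_div_iff {a b d t : ℕ} (hd : 0 < d) (ht : 0 < t) :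
    ((t : ℝ) ^ 2)⁻¹ ≤ |((a : ℝ) - b) / d| ↔ d + b * t ^ 2 ≤ a * t ^ 2 ∨ d + a * t ^ 2 ≤ b * t ^ 2 := by
  have hd' : (0 : ℝ) < d := by exact_mod_cast hd
  have ht' : (0 : ℝ) < t := by exact_mod_cast ht
  rw [abs_div, abs_of_pos hd', inv_eq_one_div, div_le_div_iff₀ (by positivity) hd', one_mul,
    ← abs_of_pos (show (0 : ℝ) < (t : ℝ) ^ 2 by positivity), ← abs_mul, le_abs]
  rw [← Nat.cast_le (α := ℝ), ← Nat.cast_le (α := ℝ) (n := b * t ^ 2)]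
  push_cast
  constructor
  · rintro (h | h)
    · left; linarith
    · right; linarith
  · rintro (h | h)
    · left; linarith
    · right; linarith

theorem primrec_pow : Primrec₂ fun a b : ℕ => a ^ b := by
  refine (Primrec.nat_rec' (f := fun y : ℕ × ℕ => y.2) (g := fun _ => 1)
    (h := fun y z => z.2 * y.1) Primrec.snd (Primrec.const 1)
    (Primrec.nat_mul.comp (Primrec.snd.comp Primrec.snd) (Primrec.fst.comp Primrec.fst)).to₂).of_eq
    fun y => ?_
  obtain ⟨a, b⟩ := y
  simp only
  induction b with
  | zero => rfl
  | succ b ih => simp only [pow_succ, ← ih]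

theorem isComputableOpenSeq_driftTest : IsComputableOpenSeq driftTest := by
  -- The default `false` is never read in accepted words: `R` requires length beyond `(t + 1) ^ 5`.
  -- That also bounds the search for `t` by the length.
  let S : ℕ → ℕ × List Bool → ℕ × ℕ × ℕ := fun t a =>
    fracSum (fun n => a.2.getD n false) (t ^ 5) ((t + 1) ^ 5 - t ^ 5)
  let R : ℕ → ℕ × List Bool → Prop := fun t a =>
    32 * 2 ^ a.1 < t ∧ (t + 1) ^ 5 < a.2.length ∧
      ((S t a).2.2 + (S t a).2.1 * t ^ 2 ≤ (S t a).1 * t ^ 2 ∨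
        (S t a).2.2 + (S t a).1 * t ^ 2 ≤ (S t a).2.1 * t ^ 2)
  have ht : Primrec fun y : ℕ × ℕ × List Bool => y.1 := Primrec.fst
  have hi : Primrec fun y : ℕ × ℕ × List Bool => y.2.1 := Primrec.fst.comp Primrec.snd
  have hw : Primrec fun y : ℕ × ℕ × List Bool => y.2.2 := Primrec.snd.comp Primrec.snd
  have ht5 : Primrec fun y : ℕ × ℕ × List Bool => y.1 ^ 5 := primrec_pow.comp ht (Primrec.const 5)
  have ht2 : Primrec fun y : ℕ × ℕ × List Bool => y.1 ^ 2 := primrec_pow.comp ht (Primrec.const 2)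
  have hs5 : Primrec fun y : ℕ × ℕ × List Bool => (y.1 + 1) ^ 5 :=
    primrec_pow.comp (Primrec.nat_add.comp ht (Primrec.const 1)) (Primrec.const 5)
  have hS : Primrec fun y : ℕ × ℕ × List Bool => S y.1 y.2 :=
    primrec_fracSum (f := fun (y : ℕ × ℕ × List Bool) n => y.2.2.getD n false)
      ((Primrec.list_getD false).comp (hw.comp Primrec.fst) Primrec.snd).to₂
      ht5 (Primrec.nat_sub.comp hs5 ht5)
  have h1 := Primrec.fst.comp hS
  have h2 := Primrec.fst.comp (Primrec.snd.comp hS)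
  have h3 := Primrec.snd.comp (Primrec.snd.comp hS)
  have hR : PrimrecRel R := by
    have hA : PrimrecPred fun y : ℕ × ℕ × List Bool => 32 * 2 ^ y.2.1 < y.1 :=
      Primrec.nat_lt.comp
        (Primrec.nat_mul.comp (Primrec.const 32) (primrec_pow.comp (Primrec.const 2) hi)) ht
    have hB : PrimrecPred fun y : ℕ × ℕ × List Bool => (y.1 + 1) ^ 5 < y.2.2.length :=
      Primrec.nat_lt.comp hs5 (Primrec.list_length.comp hw)
    have hC : PrimrecPred fun y : ℕ × ℕ × List Bool =>
        (S y.1 y.2).2.2 + (S y.1 y.2).2.1 * y.1 ^ 2 ≤ (S y.1 y.2).1 * y.1 ^ 2 :=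
      Primrec.nat_le.comp (Primrec.nat_add.comp h3 (Primrec.nat_mul.comp h2 ht2))
        (Primrec.nat_mul.comp h1 ht2)
    have hD : PrimrecPred fun y : ℕ × ℕ × List Bool =>
        (S y.1 y.2).2.2 + (S y.1 y.2).1 * y.1 ^ 2 ≤ (S y.1 y.2).2.1 * y.1 ^ 2 :=
      Primrec.nat_le.comp (Primrec.nat_add.comp h3 (Primrec.nat_mul.comp h1 ht2))
        (Primrec.nat_mul.comp h2 ht2)
    exact hA.and (hB.and (hC.or hD))
  have hW : PrimrecPred fun a : ℕ × List Bool => ∃ t < a.2.length, R t a :=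
    ((PrimrecRel.exists_mem_list hR).comp (f := fun a : ℕ × List Bool => List.range a.2.length)
      (Primrec.list_range.comp (Primrec.list_length.comp Primrec.snd)) Primrec.id).of_eq
      fun a => by simp only [List.mem_range, id]
  refine ⟨_, hW.computablePred.to_re, fun i => ?_⟩
  have key : ∀ (x : Cantor) (w : List Bool) (t : ℕ), pre x w.length = w → 32 * 2 ^ i < t →
      (t + 1) ^ 5 < w.length →
      (R t (i, w) ↔ ((t : ℝ) ^ 2)⁻¹ ≤ |psum x (t ^ 5) ((t + 1) ^ 5)|) := by
    intro x w t hx ht hlen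
    have hle : t ^ 5 ≤ (t + 1) ^ 5 := Nat.pow_le_pow_left t.le_succ 5
    have hS : S t (i, w) = fracSum x (t ^ 5) ((t + 1) ^ 5 - t ^ 5) := by
      refine fracSum_congr fun n hn => ?_
      have hn' : n < w.length := by omega
      simp only
      rw [List.getD_eq_getElem?_getD, ← hx, pre_getElem? x hn', Option.getD_some]
    have he := fracSum_eq x (t ^ 5) ((t + 1) ^ 5 - t ^ 5)
    rw [Nat.add_sub_of_le hle] at he
    rw [← he, inv_sq_le_abs_div_iff (fracSum_den_pos _ _ _) (by omega)]
    simp only [R, hS, ht, hlen, true_and]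
  ext x
  constructor
  · rintro ⟨t, ht, hx⟩
    have hlen : (t + 1) ^ 5 < (pre x ((t + 1) ^ 5 + 1)).length := by rw [pre_length]; omega
    refine ⟨pre x ((t + 1) ^ 5 + 1), ⟨t, ?_, ?_⟩, by rw [pre_length]⟩
    · exact lt_of_lt_of_le (Nat.lt_succ_self t) ((Nat.le_self_pow (by norm_num) _).trans hlen.le)
    · exact (key x _ t (by rw [pre_length]) ht hlen).2 hx
  · rintro ⟨w, ⟨t, -, hR⟩, hx⟩
    exact ⟨t, hR.1, (key x w t hx hR.1 hR.2.1).1 hR⟩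

theorem isMLTest_driftTest : IsMLTest driftTest :=
  ⟨isComputableOpenSeq_driftTest, lam_driftTest_le⟩

theorem driftTest_antitone {i l : ℕ} (h : i ≤ l) : driftTest l ⊆ driftTest i := by
  rintro x ⟨t, ht, hx⟩
  exact ⟨t, lt_of_le_of_lt (Nat.mul_le_mul_left 32 (Nat.pow_le_pow_right two_pos h)) ht, hx⟩

/-- The index from which on the partial sums are within `2^{-i}`. -/
def cutoff (i : ℕ) : ℕ := (32 * 2 ^ i + 1) ^ 5

theorem abs_psum_le_card (x : Cantor) {N M : ℕ} (hN : 0 < N) :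
    |psum x N M| ≤ (Finset.Ioc N M).card * (N : ℝ)⁻¹ := by
  have hN' : (0 : ℝ) < N := by exact_mod_cast hN
  refine (Finset.abs_sum_le_sum_abs _ _).trans ((Finset.sum_le_card_nsmul _ _ (N : ℝ)⁻¹
    fun n hn => ?_).trans (nsmul_eq_mul _ _).le)
  have hn' : (N : ℝ) ≤ n := by exact_mod_cast (Finset.mem_Ioc.1 hn).1.le
  rw [abs_mul, abs_sign, mul_one, abs_of_nonneg (by positivity)]
  gcongr

/-- Complete blocks contribute a telescoping `1 / T - 1 / (T + s)`. The last, incomplete block is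
not controlled by the test, but its absolute sum is at most `31 / (T + s)`. The total is at most `31
/ T`, and `T = 32 * 2 ^ i`. -/
theorem abs_psum_cutoff_le {x : Cantor} {i : ℕ} (hx : x ∉ driftTest i) {m : ℕ}
    (hm : cutoff i ≤ m) : |psum x 0 m - psum x 0 (cutoff i)| ≤ (2 : ℝ)⁻¹ ^ i := by
  set T : ℕ := 32 * 2 ^ i with hTdef
  have hT : 1 ≤ T := by have := Nat.one_le_two_pow (n := i); omega
  have hT' : (0 : ℝ) < T := by exact_mod_cast hT
  have hD : ∀ t > T, |psum x (t ^ 5) ((t + 1) ^ 5)| ≤ ((t : ℝ) ^ 2)⁻¹ := by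
    intro t ht
    by_contra! h
    exact hx ⟨t, ht, h.le⟩
  have hblocks : ∀ s : ℕ, |psum x ((T + 1) ^ 5) ((T + 1 + s) ^ 5)| ≤
      (T : ℝ)⁻¹ - ((T : ℝ) + s)⁻¹ := by
    intro s
    induction s with
    | zero => simp [psum]
    | succ s ih =>
      have h1 : (T + 1) ^ 5 ≤ (T + 1 + s) ^ 5 := Nat.pow_le_pow_left (by omega) 5
      have h2 : (T + 1 + s) ^ 5 ≤ (T + 1 + s + 1) ^ 5 := Nat.pow_le_pow_left (by omega) 5
      rw [← add_assoc, ← psum_add x h1 h2]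
      refine (abs_add_le _ _).trans ?_
      have h3 := hD (T + 1 + s) (by omega)
      have h4 : (((T + 1 + s : ℕ) : ℝ) ^ 2)⁻¹ ≤ ((T : ℝ) + s)⁻¹ - ((T : ℝ) + (s + 1 : ℕ))⁻¹ := by
        have hs : (0 : ℝ) < T + s := by positivity
        push_cast
        rw [inv_sub_inv (by positivity) (by positivity), inv_eq_one_div,
          div_le_div_iff₀ (by positivity) (by positivity)]
        nlinarith
      linarith
  have hex : ∀ m ≥ (T + 1) ^ 5, ∃ s : ℕ, (T + 1 + s) ^ 5 ≤ m ∧ m < (T + 1 + s + 1) ^ 5 := by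
    intro m hm
    induction m, hm using Nat.le_induction with
    | base => exact ⟨0, le_rfl, Nat.pow_lt_pow_left (by omega) (by norm_num)⟩
    | succ m _ ih =>
      obtain ⟨s, h1, h2⟩ := ih
      rcases (Nat.succ_le_of_lt h2).lt_or_eq with h | h
      · exact ⟨s, h1.trans m.le_succ, h⟩
      · exact ⟨s + 1, h.ge, lt_of_eq_of_lt h (Nat.pow_lt_pow_left (by omega) (by norm_num))⟩
  obtain ⟨s, hs, hs'⟩ := hex m hm
  have h1 : cutoff i ≤ (T + 1 + s) ^ 5 := Nat.pow_le_pow_left (by omega) 5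
  rw [← psum_add x (Nat.zero_le _) hm, add_sub_cancel_left, ← psum_add x h1 hs]
  refine (abs_add_le _ _).trans ?_
  have h2 := hblocks s
  have h3 : |psum x ((T + 1 + s) ^ 5) m| ≤ 31 * ((T : ℝ) + s)⁻¹ := by
    have hs0 : (0 : ℝ) < T + s := by positivity
    refine (abs_psum_le_card x (by positivity)).trans ?_
    refine (mul_le_mul_of_nonneg_right (card_block_le (t := T + 1 + s) (by omega) hs'.le)
      (by positivity)).trans ?_
    push_cast
    calc 31 * ((T : ℝ) + 1 + s) ^ 4 * (((T : ℝ) + 1 + s) ^ 5)⁻¹ = 31 * ((T : ℝ) + 1 + s)⁻¹ := by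
          field_simp
      _ ≤ 31 * ((T : ℝ) + s)⁻¹ := by gcongr; linarith
  have h4 : ((T : ℝ) + s)⁻¹ ≤ (T : ℝ)⁻¹ := by gcongr; linarith [(Nat.cast_nonneg s : (0 : ℝ) ≤ s)]
  have h5 : (T : ℝ)⁻¹ = 32⁻¹ * (2 : ℝ)⁻¹ ^ i := by
    rw [hTdef]; push_cast; rw [mul_inv, inv_pow]
  have h6 : |psum x (cutoff i) ((T + 1 + s) ^ 5)| ≤ (T : ℝ)⁻¹ - ((T : ℝ) + s)⁻¹ := h2
  have h7 : (0 : ℝ) < (2 : ℝ)⁻¹ ^ i := by positivity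
  linarith

theorem exists_harmonicSum {x : Cantor} {i : ℕ} (hx : x ∉ driftTest i) :
    ∃ s : ℝ, HarmonicSum x s ∧ ∀ l ≥ i, |s - psum x 0 (cutoff l)| ≤ (2 : ℝ)⁻¹ ^ l := by
  have hb : ∀ l ≥ i, ∀ m ≥ cutoff l, |psum x 0 m - psum x 0 (cutoff l)| ≤ (2 : ℝ)⁻¹ ^ l :=
    fun l hl m hm => abs_psum_cutoff_le (fun h => hx (driftTest_antitone hl h)) hm
  have hc : CauchySeq fun N => psum x 0 N := by
    refine Metric.cauchySeq_iff'.2 fun ε hε => ?_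
    obtain ⟨l, hl⟩ := exists_pow_lt_of_lt_one hε (show (2 : ℝ)⁻¹ < 1 by norm_num)
    refine ⟨cutoff (max i l), fun m hm => lt_of_le_of_lt (hb _ (le_max_left i l) m hm)
      (lt_of_le_of_lt ?_ hl)⟩
    exact pow_le_pow_of_le_one (by norm_num) (by norm_num) (le_max_right i l)
  obtain ⟨s, hs⟩ := cauchySeq_tendsto_of_complete hc
  refine ⟨s, harmonicSum_iff.2 hs, fun l hl => ?_⟩
  exact le_of_tendsto ((hs.sub_const _).abs) (eventually_atTop.2 ⟨cutoff l, hb l hl⟩)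

theorem exists_harmonicSum_of_mem_MLR {p : Cantor} (hp : p ∈ MLR) : ∃ s : ℝ, HarmonicSum p s := by
  have h := hp _ isMLTest_driftTest
  rw [Set.mem_iInter, not_forall] at h
  obtain ⟨i, hi⟩ := h
  obtain ⟨s, hs, -⟩ := exists_harmonicSum hi
  exact ⟨s, hs⟩

/-- The two open conditions overlap and cover the line. Totality is what allows a realizer with
constant outputs to be chosen. -/
theorem sumApr_nonempty (z : (mlr.prod (RepSpace.rat.prod RepSpace.nat)).carrier) :
    (SumApr z).Nonempty := by
  obtain ⟨s, hs⟩ := exists_harmonicSum_of_mem_MLR z.1.2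
  by_cases h : (z.2.1 : ℝ) < s
  · exact ⟨1, s, hs, Or.inr ⟨rfl, h⟩⟩
  · refine ⟨0, s, hs, Or.inl ⟨rfl, ?_⟩⟩
    have : (0 : ℝ) < (2 : ℝ)⁻¹ ^ z.2.2 := by positivity
    linarith

/-! ### `SumApr` is layerwise computable -/

/-- Deciding `(a - b) / d < (q₀ - q₁) / (q₂ + 1) + 2^{-(k+1)}` in natural numbers. -/
theorem frac_lt_iff {a b d q₀ q₁ q₂ k : ℕ} (hd : 0 < d) :
    ((a : ℝ) - b) / d < ((q₀ : ℝ) - q₁) / (q₂ + 1) + (2 : ℝ)⁻¹ ^ (k + 1) ↔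
      a * (q₂ + 1) * 2 ^ (k + 1) + q₁ * d * 2 ^ (k + 1) <
        q₀ * d * 2 ^ (k + 1) + d * (q₂ + 1) + b * (q₂ + 1) * 2 ^ (k + 1) := by
  have hd' : (0 : ℝ) < d := by exact_mod_cast hd
  have hE : (0 : ℝ) < 2 ^ (k + 1) := by positivity
  have hq : (0 : ℝ) < (q₂ : ℝ) + 1 := by positivity
  rw [inv_pow, inv_eq_one_div, div_add_div _ _ hq.ne' hE.ne', div_lt_div_iff₀ hd' (by positivity),
    ← Nat.cast_lt (α := ℝ)]
  push_cast
  constructor <;> intro h <;> linarith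

/-- The precision used for an input word of the algorithm for `SumApr`. -/
def precision (n : ℕ) (w : List ℕ) : ℕ := w.getD 1 0 + n + w.getD 6 0 + 2

/-- The partial sum that is computed from an input word of the algorithm for `SumApr`. -/
def inputSum (n : ℕ) (w : List ℕ) : ℕ × ℕ × ℕ :=
  fracSum (fun i => decide (w.getD (4 * i) 0 = 1)) 0 (cutoff (precision n w))

/-- The decision of the algorithm for `SumApr`. -/
def BelowThreshold (n : ℕ) (w : List ℕ) : Prop :=
  (inputSum n w).1 * (w.getD 18 0 + 1) * 2 ^ (w.getD 6 0 + 1) +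
      w.getD 10 0 * (inputSum n w).2.2 * 2 ^ (w.getD 6 0 + 1) <
    w.getD 2 0 * (inputSum n w).2.2 * 2 ^ (w.getD 6 0 + 1) +
      (inputSum n w).2.2 * (w.getD 18 0 + 1) +
      (inputSum n w).2.1 * (w.getD 18 0 + 1) * 2 ^ (w.getD 6 0 + 1)

instance (n : ℕ) : DecidablePred (BelowThreshold n) := fun w => by
  unfold BelowThreshold; infer_instance

/-- The algorithm for `SumApr` on finite words. -/
def approximate (n : ℕ) (w : List ℕ) : Option ℕ :=
  if 4 * cutoff (precision n w) + 18 < w.length then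
    some (if BelowThreshold n w then 0 else 1) else none

theorem primrec_getD_const (i : ℕ) : Primrec fun w : List ℕ => w.getD i 0 :=
  (Primrec.list_getD 0).comp Primrec.id (Primrec.const i)

theorem primrec_cutoff_precision (n : ℕ) : Primrec fun w => cutoff (precision n w) := by
  have h : Primrec (precision n) :=
    Primrec.nat_add.comp (Primrec.nat_add.comp (Primrec.nat_add.comp (primrec_getD_const 1)
      (Primrec.const n)) (primrec_getD_const 6)) (Primrec.const 2)
  exact primrec_pow.comp (Primrec.nat_add.comp (Primrec.nat_mul.comp (Primrec.const 32)
    (primrec_pow.comp (Primrec.const 2) h)) (Primrec.const 1)) (Primrec.const 5)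

theorem primrec_inputSum (n : ℕ) : Primrec (inputSum n) := by
  refine primrec_fracSum (f := fun (w : List ℕ) i => decide (w.getD (4 * i) 0 = 1)) ?_
    (Primrec.const 0) (primrec_cutoff_precision n)
  have h : PrimrecPred fun y : List ℕ × ℕ => y.1.getD (4 * y.2) 0 = 1 :=
    Primrec.eq.comp ((Primrec.list_getD 0).comp Primrec.fst
      (Primrec.nat_mul.comp (Primrec.const 4) Primrec.snd)) (Primrec.const 1)
  exact h.decide.to₂

theorem computable_approximate (n : ℕ) : Computable (approximate n) := by
  have hS := primrec_inputSum n
  have h1 := Primrec.fst.comp hS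
  have h2 := Primrec.fst.comp (Primrec.snd.comp hS)
  have h3 := Primrec.snd.comp (Primrec.snd.comp hS)
  have hq := Primrec.nat_add.comp (primrec_getD_const 18) (Primrec.const 1)
  have hE := primrec_pow.comp (Primrec.const 2)
    (Primrec.nat_add.comp (primrec_getD_const 6) (Primrec.const 1))
  have hB : PrimrecPred (BelowThreshold n) :=
    Primrec.nat_lt.comp
      (Primrec.nat_add.comp (Primrec.nat_mul.comp (Primrec.nat_mul.comp h1 hq) hE)
        (Primrec.nat_mul.comp (Primrec.nat_mul.comp (primrec_getD_const 10) h3) hE))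
      (Primrec.nat_add.comp (Primrec.nat_add.comp
        (Primrec.nat_mul.comp (Primrec.nat_mul.comp (primrec_getD_const 2) h3) hE)
        (Primrec.nat_mul.comp h3 hq)) (Primrec.nat_mul.comp (Primrec.nat_mul.comp h2 hq) hE))
  have hL : PrimrecPred fun w : List ℕ => 4 * cutoff (precision n w) + 18 < w.length :=
    Primrec.nat_lt.comp (Primrec.nat_add.comp (Primrec.nat_mul.comp (Primrec.const 4)
      (primrec_cutoff_precision n)) (Primrec.const 18)) Primrec.list_length
  exact (Primrec.ite hL (Primrec.option_some.comp
    (Primrec.ite hB (Primrec.const 0) (Primrec.const 1))) (Primrec.const none)).to_comp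

/-- The length condition ensures that every entry consulted already lies in the shorter word. -/
theorem approximate_mono (n : ℕ) (u v : List ℕ) (huv : u <+: v) (b : ℕ)
    (hb : approximate n u = some b) : approximate n v = some b := by
  obtain ⟨t, rfl⟩ := huv
  by_cases hlen : 4 * cutoff (precision n u) + 18 < u.length
  swap
  · rw [approximate, if_neg hlen] at hb
    cases hb
  have hg : ∀ i < u.length, (u ++ t).getD i 0 = u.getD i 0 := fun i hi =>
    List.getD_append _ _ _ _ hi
  have hp : precision n (u ++ t) = precision n u := by
    rw [precision, hg 1 (by omega), hg 6 (by omega), precision]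
  have hs : inputSum n (u ++ t) = inputSum n u := by
    rw [inputSum, hp, inputSum]
    refine fracSum_congr fun i hi => ?_
    rw [hg (4 * i) (by omega)]
  have hB : BelowThreshold n (u ++ t) ↔ BelowThreshold n u := by
    unfold BelowThreshold
    rw [hs, hg 2 (by omega), hg 6 (by omega), hg 10 (by omega), hg 18 (by omega)]
  have hlen' : 4 * cutoff (precision n (u ++ t)) + 18 < (u ++ t).length := by
    rw [hp, List.length_append]
    omega
  rw [approximate, if_pos hlen] at hb
  rw [← hb, approximate, if_pos hlen']
  simp only [hB]

theorem layerwiseComputableWith_sumApr {U : ℕ → Set Cantor} (hU : IsOptimalMLTest U) :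
    LayerwiseComputableWith U SumApr := by
  obtain ⟨n, hn⟩ := hU.2 _ isMLTest_driftTest
  obtain ⟨F, hF, hF'⟩ := exists_computableBaire_const (computable_approximate n)
    (approximate_mono n)
  refine ⟨F, hF, ?_⟩
  rintro P ⟨⟨⟨x, q, k⟩, j⟩, hxU⟩ ⟨⟨hPx, hPq, hPk⟩, hPj⟩
  replace hxU : x.1 ∉ U j := hxU
  -- Unravelling the nested pairing: bit `i` of `x` sits at `4 * i`, the rational at 2, 10, 18, `k`
  -- at 6 and `j` at 1.
  replace hPx : ∀ i, P (2 * (2 * i)) = (x.1 i).toNat := hPx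
  replace hPq : ((P 2 : ℚ) - (P 10 : ℚ)) / ((P 18 : ℚ) + 1) = q := hPq
  replace hPk : P 6 = k := hPk
  replace hPj : P 1 = j := hPj
  -- `j + n` reaches a component of `driftTest` that `x` avoids; `k + 2` makes the error at most a
  -- quarter of `2 ^ (-k)`, less than the distance from the threshold `q + 2 ^ (-(k + 1))` to either
  -- end.
  set l := j + n + k + 2 with hl
  set w := pre P (4 * cutoff l + 19) with hw
  have hg : ∀ i < 4 * cutoff l + 19, w.getD i 0 = P i := fun i hi => by
    rw [List.getD_eq_getElem?_getD, hw, pre_getElem? P hi, Option.getD_some]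
  have hp : precision n w = l := by
    rw [precision, hg 1 (by omega), hg 6 (by omega), hPk, hPj]
  have hS : inputSum n w = fracSum x.1 0 (cutoff l) := by
    rw [inputSum, hp]
    refine fracSum_congr fun i hi => ?_
    rw [hg _ (by omega), show 4 * i = 2 * (2 * i) by ring, hPx]
    cases x.1 i <;> rfl
  have hlen : 4 * cutoff (precision n w) + 18 < w.length := by
    rw [hp, hw, pre_length]
    omega
  have hout : approximate n w = some (if BelowThreshold n w then 0 else 1) := if_pos hlen
  obtain ⟨s, hs, hsl⟩ := exists_harmonicSum fun h => hxU (hn j h)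
  have hA := abs_le.1 (hsl l (by omega))
  have hfrac := fracSum_eq x.1 0 (cutoff l)
  rw [zero_add] at hfrac
  have hqR : ((P 2 : ℝ) - P 10) / ((P 18 : ℝ) + 1) = q := by rw [← hPq]; push_cast; rfl
  have hB : BelowThreshold n w ↔ psum x.1 0 (cutoff l) < (q : ℝ) + (2 : ℝ)⁻¹ ^ (k + 1) := by
    rw [← hfrac, ← hqR, frac_lt_iff (fracSum_den_pos _ _ _), BelowThreshold, hS,
      hg 2 (by omega), hg 6 (by omega), hg 10 (by omega), hg 18 (by omega), hPk]
  have hk : (0 : ℝ) < (2 : ℝ)⁻¹ ^ k := by positivity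
  have hlk : (2 : ℝ)⁻¹ ^ l ≤ (2 : ℝ)⁻¹ ^ k * 4⁻¹ := by
    calc (2 : ℝ)⁻¹ ^ l ≤ (2 : ℝ)⁻¹ ^ (k + 2) :=
          pow_le_pow_of_le_one (by norm_num) (by norm_num) (by omega)
      _ = (2 : ℝ)⁻¹ ^ k * 4⁻¹ := by rw [pow_add]; norm_num
  rw [pow_succ] at hB
  by_cases hb : BelowThreshold n w
  · rw [if_pos hb] at hout
    refine ⟨_, hF' P _ 0 hout, (0 : Fin 2), ⟨s, hs, Or.inl ⟨rfl, ?_⟩⟩, rfl⟩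
    have := hB.1 hb
    change s < (q : ℝ) + (2 : ℝ)⁻¹ ^ k
    linarith [hA.2]
  · rw [if_neg hb] at hout
    refine ⟨_, hF' P _ 1 hout, (1 : Fin 2), ⟨s, hs, Or.inr ⟨rfl, ?_⟩⟩, rfl⟩
    have := not_lt.1 (mt hB.2 hb)
    change (q : ℝ) < s
    linarith [hA.1]

/-! ### `SumApr` is not computable -/

/-- Flipping starts at `m + 1`, so the terms up to `m` agree and the later ones cancel. -/
theorem psum_flipFrom {x : Cantor} {m M : ℕ} (h : m ≤ M) :
    psum x 0 M + psum (flipFrom (m + 1) x) 0 M = 2 * psum x 0 m := by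
  have h1 : psum (flipFrom (m + 1) x) 0 m = psum x 0 m := by
    refine Finset.sum_congr rfl fun n hn => ?_
    rw [sign, sign, flipFrom, if_pos (Nat.lt_succ_of_le (Finset.mem_Ioc.1 hn).2)]
  have h2 : psum (flipFrom (m + 1) x) m M = -psum x m M := by
    rw [psum, psum, ← Finset.sum_neg_distrib]
    refine Finset.sum_congr rfl fun n hn => ?_
    rw [sign, sign, flipFrom, if_neg (by have := (Finset.mem_Ioc.1 hn).1; omega)]
    cases x n <;> simp
  rw [← psum_add x (Nat.zero_le m) h, ← psum_add (flipFrom (m + 1) x) (Nat.zero_le m) h, h1, h2]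
  ring

theorem exists_one_le_psum (b : Bool) {x : Cantor} {n : ℕ} (hx : ∀ i ≥ n, x i = b) :
    ∃ m ≥ n, 1 ≤ (-1 : ℝ) ^ b.toNat * psum x 0 m := by
  have hdiv : Tendsto (fun m : ℕ => ∑ i ∈ Finset.range m, (i : ℝ)⁻¹) atTop atTop :=
    (not_summable_iff_tendsto_nat_atTop_of_nonneg fun i => by positivity).1
      Real.not_summable_natCast_inv
  obtain ⟨m, hm, hnm⟩ := ((hdiv.eventually_ge_atTop
    (1 + ∑ i ∈ Finset.range n, 2)).and (eventually_ge_atTop n)).exists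
  refine ⟨m, hnm, ?_⟩
  have h1 : psum x 0 m = ∑ i ∈ Finset.range (m + 1), (i : ℝ)⁻¹ * sign i x := by
    rw [psum, Finset.range_eq_Ico, Finset.sum_eq_sum_Ico_succ_bot (Nat.succ_pos m)]
    simp only [Nat.cast_zero, inv_zero, zero_mul, zero_add]
    refine Finset.sum_congr ?_ fun _ _ => rfl
    ext i
    simp only [Finset.mem_Ioc, Finset.mem_Ico]
    omega
  -- An unfavourable sign costs `2 / i ≤ 2`, and can occur only below `n`; the index 0 is harmless
  -- since its inverse is 0.
  have hterm : ∀ i : ℕ, (i : ℝ)⁻¹ - (if i < n then 2 else 0) ≤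
      (-1 : ℝ) ^ b.toNat * ((i : ℝ)⁻¹ * sign i x) := by
    intro i
    have hi0 : (0 : ℝ) ≤ (i : ℝ)⁻¹ := by positivity
    have hi1 : (i : ℝ)⁻¹ ≤ 1 := Nat.cast_inv_le_one i
    split_ifs with hi
    · have h : |(-1 : ℝ) ^ b.toNat * ((i : ℝ)⁻¹ * sign i x)| = (i : ℝ)⁻¹ := by
        rw [abs_mul, abs_mul, abs_sign, abs_of_nonneg hi0]
        simp
      linarith [(abs_le.1 h.le).1]
    · rw [sign, hx i (not_lt.1 hi)]
      cases b <;> simp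
  rw [h1, Finset.mul_sum]
  refine le_trans ?_ (Finset.sum_le_sum fun i _ => hterm i)
  rw [Finset.sum_sub_distrib, Finset.sum_range_succ]
  have h2 : ∑ i ∈ Finset.range (m + 1), (if i < n then (2 : ℝ) else 0) =
      ∑ i ∈ Finset.range n, 2 := by
    rw [← Finset.sum_filter]
    refine Finset.sum_congr ?_ fun _ _ => rfl
    ext i
    simp only [Finset.mem_filter, Finset.mem_range]
    omega
  rw [h2]
  have h3 : (0 : ℝ) ≤ (m : ℝ)⁻¹ := by positivity
  linarith

/-- The random sequences whose series has a large sum of a prescribed sign are dense. -/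
theorem exists_random_harmonicSum (b : Bool) (x : Cantor) (n : ℕ) :
    ∃ p ∈ MLR, (∀ i < n, p i = x i) ∧
      ∀ s, HarmonicSum p s → 1 ≤ (-1 : ℝ) ^ b.toNat * s := by
  let x' : Cantor := fun i => if i < n then x i else b
  obtain ⟨m, hnm, hm⟩ := exists_one_le_psum b (x := x') (n := n) fun i hi => if_neg (not_lt.2 hi)
  have hS : lam (MLR ∩ flipFrom (m + 1) ⁻¹' MLR)ᶜ = 0 := by
    rw [Set.compl_inter, ← Set.preimage_compl]
    exact measure_union_null lam_compl_MLR
      ((measurePreserving_flipFrom (m + 1)).quasiMeasurePreserving.preimage_null lam_compl_MLR)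
  obtain ⟨p, ⟨hp, hp'⟩, hpx⟩ := exists_mem_agree hS x' (m + 1)
  have hpm : psum p 0 m = psum x' 0 m := by
    refine Finset.sum_congr rfl fun i hi => ?_
    rw [sign, sign, hpx i (Nat.lt_succ_of_le (Finset.mem_Ioc.1 hi).2)]
  have hagree : ∀ i < n, p i = x i := fun i hi => by
    rw [hpx i (by omega)]
    exact if_pos hi
  have hagree' : ∀ i < n, flipFrom (m + 1) p i = x i := fun i hi => by
    rw [flipFrom, if_pos (by omega), hagree i hi]
  obtain ⟨s, hs⟩ := exists_harmonicSum_of_mem_MLR hp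
  obtain ⟨s', hs'⟩ := exists_harmonicSum_of_mem_MLR hp'
  have hadd : s + s' = 2 * psum x' 0 m := by
    refine tendsto_nhds_unique ((harmonicSum_iff.1 hs).add (harmonicSum_iff.1 hs')) ?_
    refine tendsto_const_nhds.congr' ((eventually_ge_atTop m).mono fun M hM => ?_)
    rw [← hpm]
    exact (psum_flipFrom hM).symm
  have hsum : (-1 : ℝ) ^ b.toNat * s + (-1 : ℝ) ^ b.toNat * s' =
      2 * ((-1 : ℝ) ^ b.toNat * psum x' 0 m) := by
    rw [← mul_add, hadd]
    ring
  -- The two signed sums average at least 1, so one of them is at least 1.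
  rcases le_total 1 ((-1 : ℝ) ^ b.toNat * s) with h | h
  · exact ⟨p, hp, hagree, fun r hr => tendsto_nhds_unique hs hr ▸ h⟩
  · refine ⟨_, hp', hagree', fun r hr => ?_⟩
    rw [← tendsto_nhds_unique hs' hr]
    linarith

theorem not_isComputableMulti_sumApr : ¬ IsComputableMulti SumApr := by
  rintro ⟨F, hF, hreal⟩
  -- The zero sequence names `q = 0` and `k = 0`, where answer 0 requires `s < 1` and answer 1
  -- requires `s > 0`.
  let name : Cantor → Baire := fun x => pair (fun i => (x i).toNat) fun _ => 0
  have hval : ∀ p ∈ MLR, ∃ r ∈ F (name p), ∃ s, HarmonicSum p s ∧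
      ((r 0 = 0 ∧ s < 1) ∨ (r 0 = 1 ∧ 0 < s)) := by
    intro p hp
    obtain ⟨r, hr, b, ⟨s, hs, hb⟩, hrb⟩ := hreal (name p) (⟨p, hp⟩, (0 : ℚ), (0 : ℕ)) (by
      refine ⟨fun i => ?_, ?_, ?_⟩
      · exact congrFun (pair_even (fun i => (p i).toNat) fun _ => 0) i
      · change ((pair _ _ 1 : ℚ) - (pair _ _ 5 : ℚ)) / _ = 0
        simp [pair]
      · change pair _ _ 3 = 0
        simp [pair])
    refine ⟨r, hr, s, hs, ?_⟩
    replace hrb : r 0 = b.val := hrb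
    rcases hb with ⟨rfl, h⟩ | ⟨rfl, h⟩
    · refine Or.inl ⟨hrb, ?_⟩
      simpa using h
    · refine Or.inr ⟨hrb, ?_⟩
      simpa using h
  obtain ⟨p, hp, -⟩ := exists_mem_agree lam_compl_MLR (fun _ => false) 0
  obtain ⟨r, hr, -⟩ := hval p hp
  obtain ⟨k, hk⟩ := hF.continuous_zero hr
  have hsign : ∀ b : Bool, ∃ s : ℝ, 1 ≤ (-1 : ℝ) ^ b.toNat * s ∧
      ((r 0 = 0 ∧ s < 1) ∨ (r 0 = 1 ∧ 0 < s)) := by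
    intro b
    obtain ⟨y, hy, hyp, hys⟩ := exists_random_harmonicSum b p k
    obtain ⟨r', hr', s, hs, h⟩ := hval y hy
    rw [hk _ (pair_congr_left fun i hi => by rw [hyp i hi]) r' hr'] at h
    exact ⟨s, hys s hs, h⟩
  obtain ⟨s, hs, h | h⟩ := hsign false
  · norm_num at hs
    linarith [h.2]
  · obtain ⟨s', hs', h' | h'⟩ := hsign true
    · omega
    · norm_num at hs'
      linarith [h'.2]

end TTE

theorem corollary28 :
    (∀ p ∈ TTE.MLR, ∃ s : ℝ, TTE.HarmonicSum p s) ∧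
    (∀ U : ℕ → Set TTE.Cantor, TTE.IsOptimalMLTest U →
      TTE.LayerwiseComputableWith U TTE.SumApr) ∧
    ¬ TTE.IsComputableMulti TTE.SumApr ∧
    (∀ U : ℕ → Set TTE.Cantor, TTE.IsUniversalMLTest U →
      ¬ TTE.WeihrauchHardForLayerwise U TTE.SumApr ∧
      ¬ TTE.WeihrauchCompleteForLayerwise U TTE.SumApr) := by
  have hard : ∀ U : ℕ → Set TTE.Cantor, TTE.IsUniversalMLTest U →
      ¬ TTE.WeihrauchHardForLayerwise U TTE.SumApr := fun U hU h =>
    TTE.not_weihrauchLE_layerBound hU TTE.SumApr TTE.sumApr_nonempty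
      (h _ _ (TTE.layerwiseComputable_layerBound U))
  exact ⟨fun p hp => TTE.exists_harmonicSum_of_mem_MLR hp,
    fun U hU => TTE.layerwiseComputableWith_sumApr hU,
    TTE.not_isComputableMulti_sumApr,
    fun U hU => ⟨hard U hU, fun h => hard U hU h.2⟩⟩
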